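/- Let $n\ge 0$ be an integer, $\mathbf{k}$ a commutative ring, and $\mathcal{A}=\mathbf{k}[S_n]$ the group algebra of the symmetric group $S_n$ on $[n]=\{1,\dots,n\}$, with product $(uw)(i)=u(w(i))$ on $S_n$. Let $[n-1]=\{1,\dots,n-1\}$ (empty if $n\le 1$). A composition of $n$ is a finite sequence $\alpha=(\alpha_1,\dots,\alpha_p)$ of positive integers with sum $n$; write $\ell(\alpha)=p$, and let $\mathrm{Comp}_n$ be the set of all compositions of $n$. The map $\alpha\mapsto \mathrm{Set}(\alpha)=\{\alpha_1+\cdots+\alpha_i \mid 1\le i<p\}$ is a bijection from $\mathrm{Comp}_n$ to the subsets of $[n-1]$; let $\mathrm{Comp}$ denote its inverse. For $w\in S_n$ let $\mathrm{Des}(w)=\{i\in[n-1]\mid w(i)>w(i+1)\}$. For $I\subseteq[n-1]$ let $\mathbf{B}_I=\sum_{w\in S_n,\ \mathrm{Des}(w)\subseteq I} w\in\mathcal{A}$, and for $\alpha\in\mathrm{Comp}_n$ let $\mathbf{B}_\alpha=\mathbf{B}_{\mathrm{Set}(\alpha)}$. The descent algebra $\Sigma_n$ is the $\mathbf{k}$-linear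 span of the $\mathbf{B}_\alpha$, $\alpha\in\mathrm{Comp}_n$. For $w\in S_n$ let $\mathrm{LRM}(w)=\{i\in[n]\mid w(k)>i\text{ for all }k<w^{-1}(i)\}$ be the set of its left-to-right minima, and let $\mathrm{LRM}'(w)=\{\ell-1\mid \ell\in\mathrm{LRM}(w),\ \ell>1\}\subseteq[n-1]$ and $\mathrm{cLRM}'(w)=\mathrm{Comp}(\mathrm{LRM}'(w))$. For $\alpha,\beta\in\mathrm{Comp}_n$ let $\eta_\beta(\alpha)$ be the number of maps $f:[\ell(\beta)]\to[\ell(\alpha)]$ such that $\alpha_j=\sum_{i\in f^{-1}(j)}\beta_i$ for every $j\in[\ell(\alpha)]$. Then the family $(b_w)_{w\in S_n}$, $b_w=\mathbf{B}_{\mathrm{LRM}'(w)}\,w$, is a basis of the $\mathbf{k}$-module $\mathcal{A}$, and there is a total order $<$ on $\mathrm{Comp}_n$, depending only on $n$, such that the following holds for every $\mathbf{k}$ and every element $\mathbf{a}=\sum_{\alpha\in\mathrm{Comp}_n}\lambda_\alpha\mathbf{B}_\alpha$ of $\Sigma_n$ (with $\lambda_\alpha\in\mathbf{k}$). The linear map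 $L_{\mathbf a}:\mathcal{A}\to\mathcal{A}$, $\mathbf{x}\mapsto\mathbf{a}\mathbf{x}$, is represented with respect to the basis $(b_w)_{w\in S_n}$ by a triangular matrix: if $u\ne w$ and the coefficient of $b_u$ in $\mathbf{a}b_w$ is nonzero, then $\mathrm{cLRM}'(u)<\mathrm{cLRM}'(w)$. The diagonal entry of this matrix at $w\in S_n$ (that is, the coefficient of $b_w$ in $\mathbf{a}b_w$) is $\sum_{\alpha\in\mathrm{Comp}_n}\lambda_\alpha\,\eta_{\mathrm{cLRM}'(w)}(\alpha)$. Consequently these numbers, for $w\in S_n$, are the eigenvalues of $L_{\mathbf a}$ listed with their algebraic multiplicities, i.e., the characteristic polynomial of $L_{\mathbf a}$ is $$\prod_{w\in S_n}\Bigl(X-\sum_{\alpha\in\mathrm{Comp}_n}\lambda_\alpha\,\eta_{\mathrm{cLRM}'(w)}(\alpha)\Bigr).$$ -/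

import Mathlib

namespace DescentAlgebra

/-! Permutations of `{1, …, n}` are modelled by `Equiv.Perm (Fin n)`, with `i : Fin n` standing for
the number `i + 1`; subsets of `[n - 1]` by `Finset (Fin (n - 1))`, again with `j` standing for
`j + 1`. The product `u * w` of permutations is `i ↦ u (w i)`. -/

/-- The element `j + 1` of `Fin n`, for `j : Fin (n - 1)`. -/
def next {n : ℕ} (j : Fin (n - 1)) : Fin n := ⟨(j : ℕ) + 1, by omega⟩

/-- The element `j` of `Fin n`, for `j : Fin (n - 1)`. -/
def here {n : ℕ} (j : Fin (n - 1)) : Fin n := ⟨(j : ℕ), by omega⟩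

/-- The descent set of a permutation. -/
def Des {n : ℕ} (w : Equiv.Perm (Fin n)) : Finset (Fin (n - 1)) :=
  Finset.univ.filter fun j => w (next j) < w (here j)

/-- The subset `{α₁, α₁ + α₂, …, α₁ + ⋯ + α_{p-1}}` of `[n - 1]` attached to a composition
`(α₁, …, α_p)` of `n`. -/
def setOf {n : ℕ} (α : Composition n) : Finset (Fin (n - 1)) :=
  compositionAsSetEquiv n (compositionEquiv n α)

/-- The composition of `n` attached to a subset of `[n - 1]`, inverse to `setOf`. -/
def compOf {n : ℕ} (I : Finset (Fin (n - 1))) : Composition n :=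
  (compositionEquiv n).symm ((compositionAsSetEquiv n).symm I)

/-- The set of left-to-right minima (entries, not positions) of a permutation. -/
def LRM {n : ℕ} (w : Equiv.Perm (Fin n)) : Finset (Fin n) :=
  Finset.univ.filter fun i => ∀ k, k < w⁻¹ i → i < w k

/-- The set `{ℓ - 1 | ℓ ∈ LRM(w), ℓ > 1}`, a subset of `[n - 1]`. -/
def LRM' {n : ℕ} (w : Equiv.Perm (Fin n)) : Finset (Fin (n - 1)) :=
  Finset.univ.filter fun j => next j ∈ LRM w

/-- The composition attached to `LRM' w`. -/
def cLRM' {n : ℕ} (w : Equiv.Perm (Fin n)) : Composition n := compOf (LRM' w)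

/-- The element `B_I` of the group algebra: the sum of all permutations whose descent set is
contained in `I`. -/
noncomputable def BSet (k : Type*) [CommRing k] {n : ℕ} (I : Finset (Fin (n - 1))) :
    MonoidAlgebra k (Equiv.Perm (Fin n)) :=
  ∑ w ∈ Finset.univ.filter (fun w : Equiv.Perm (Fin n) => Des w ⊆ I), MonoidAlgebra.single w 1

/-- The element `B_α` of the group algebra, for a composition `α` of `n`. -/
noncomputable def B (k : Type*) [CommRing k] {n : ℕ} (α : Composition n) :
    MonoidAlgebra k (Equiv.Perm (Fin n)) :=
  BSet k (setOf α)

/-- The number `η_β(α)` of maps `f : [ℓ(β)] → [ℓ(α)]` such that each part `α_j` is the sum of the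
parts `β_i` with `f i = j`. -/
def eta {n : ℕ} (β α : Composition n) : ℕ :=
  Fintype.card {f : Fin β.length → Fin α.length //
    ∀ j, α.blocksFun j = ∑ i ∈ Finset.univ.filter (fun i => f i = j), β.blocksFun i}

/-- The element `B_{LRM'(w)} w` of the group algebra. -/
noncomputable def lrmVector (k : Type*) [CommRing k] {n : ℕ} (w : Equiv.Perm (Fin n)) :
    MonoidAlgebra k (Equiv.Perm (Fin n)) :=
  BSet k (LRM' w) * MonoidAlgebra.single w 1

end DescentAlgebra

namespace DescentAlgebra

open Finset

variable {n : ℕ}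

/-! ### Compositions and their index functions -/

/-! Read a permutation `z` through its inverse word, which lists the letters `a` by increasing `z
a`. Then `b_w` is the sum of all shuffles of the factors obtained by cutting the word of `w` in
front of each left-to-right minimum. More generally, `chainSum g w` sums the shuffles of the
subwords of `w` carried by the fibres of `g`. Multiplication by `B_α` refines the fibres in every
admissible way (`B_mul_chainSum`). Refinements that split no fibre return the same sum, and `η`
counts them (`card_splittings_const`); all others have more fibres.

A shuffle sum with `r` fibres is a combination of the `b_u` with at least `r` factors
(`chainSum_mem_lrmSpan`). This is a multilinear Lyndon expansion: a word with distinct letters is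
Lyndon exactly when it starts with its smallest letter. Hence the `b_u` span, form a basis by
counting, and make `L_a` triangular with respect to the number of factors. -/

theorem rel_of_adjacent {ι : Type*} (h : Fin n → ι)
    (hconv : ∀ a c b, a ≤ c → c ≤ b → h a = h b → h a = h c)
    (P : Fin n → Fin n → Prop) (trans : ∀ a b c, P a b → P b c → P a c)
    (hs : ∀ t : Fin (n - 1), h (here t) = h (next t) → P (here t) (next t)) :
    ∀ a b, a < b → h a = h b → P a b := by
  have key : ∀ d (a b : Fin n), (b : ℕ) = a + d + 1 → h a = h b → P a b := by
    intro d
    induction d with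
    | zero =>
      intro a b hab e
      obtain ⟨t, rfl, rfl⟩ : ∃ t : Fin (n - 1), here t = a ∧ next t = b :=
        ⟨⟨a, by omega⟩, rfl, Fin.ext hab.symm⟩
      exact hs _ e
    | succ d ih =>
      intro a b hab e
      obtain ⟨t, ht, rfl⟩ : ∃ t : Fin (n - 1), (here t : ℕ) = a + d + 1 ∧ next t = b :=
        ⟨⟨a + d + 1, by omega⟩, rfl, Fin.ext (by simp only [next]; omega)⟩
      have hac : h a = h (here t) :=
        hconv a _ _ (Fin.le_def.2 (by omega)) (Fin.le_def.2 (by omega)) e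
      exact trans _ _ _ (ih a _ ht hac) (hs _ (hac.symm.trans e))
  intro a b hab e
  exact key (b - a - 1) a b (by have := Fin.lt_def.1 hab; omega) e

theorem index_mono (α : Composition n) : Monotone α.index := by
  intro i j hij
  by_contra! H
  have h1 := α.lt_sizeUpTo_index_succ j
  have h2 := α.sizeUpTo_index_le i
  have h3 : α.sizeUpTo (α.index j).succ ≤ α.sizeUpTo (α.index i) :=
    α.monotone_sizeUpTo (by simpa using Fin.lt_def.1 H)
  have := Fin.le_def.1 hij
  omega

theorem index_convex (α : Composition n) (a c b : Fin n) (hac : a ≤ c) (hcb : c ≤ b)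
    (h : α.index a = α.index b) : α.index a = α.index c :=
  le_antisymm (index_mono α hac) (h ▸ index_mono α hcb)

theorem mem_setOf_iff (α : Composition n) (t : Fin (n - 1)) :
    t ∈ setOf α ↔ α.index (here t) ≠ α.index (next t) := by
  have h0 : t ∈ setOf α ↔ ∃ i : Fin (α.length + 1), α.sizeUpTo i = t + 1 := by
    simp only [setOf, compositionAsSetEquiv, compositionEquiv, Equiv.coe_fn_mk,
      Composition.toCompositionAsSet, Composition.boundaries, Composition.boundary]
    simp [Fin.ext_iff, add_comm]
  rw [h0]
  have e1 : ((here t : Fin n) : ℕ) = t := rfl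
  have e2 : ((next t : Fin n) : ℕ) = t + 1 := rfl
  have a1 := α.lt_sizeUpTo_index_succ (here t)
  have a2 := α.sizeUpTo_index_le (here t)
  have b1 := α.lt_sizeUpTo_index_succ (next t)
  have b2 := α.sizeUpTo_index_le (next t)
  rw [e1] at a1 a2
  rw [e2] at b1 b2
  constructor
  · rintro ⟨i, hi⟩ e
    rw [← e] at b1 b2
    have h1 : ((α.index (here t)) : ℕ) < i := by
      by_contra! H
      have := α.monotone_sizeUpTo H
      omega
    have := α.monotone_sizeUpTo (Nat.succ_le_of_lt h1)
    simp only [Fin.val_succ, Nat.succ_eq_add_one] at *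
    omega
  · intro hne
    have hlt : α.index (here t) < α.index (next t) :=
      lt_of_le_of_ne (index_mono α (Fin.le_def.2 (by omega))) hne
    refine ⟨(α.index (next t)).castSucc, ?_⟩
    have := α.monotone_sizeUpTo (Nat.succ_le_of_lt (Fin.lt_def.1 hlt))
    simp only [Fin.val_succ, Nat.succ_eq_add_one, Fin.val_castSucc] at *
    omega

theorem setOf_compOf (I : Finset (Fin (n - 1))) : setOf (compOf I) = I := by
  simp [setOf, compOf]

theorem index_surjective (α : Composition n) : Function.Surjective α.index := fun i =>
  ⟨α.embedding i ⟨0, α.one_le_blocksFun i⟩, α.index_embedding i _⟩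

theorem card_index_fiber (α : Composition n) (i : Fin α.length) :
    #{a | α.index a = i} = α.blocksFun i := by
  have : ({a | α.index a = i} : Finset (Fin n)) = univ.map (α.embedding i).toEmbedding := by
    ext a
    have := α.mem_range_embedding_iff' (j := a) (i := i)
    simp only [Set.mem_range] at this
    simp [this, eq_comm (a := i)]
  rw [this, card_map, card_univ, Fintype.card_fin]

/-- Two monotone functions with fibres of the same sizes coincide. -/
theorem monotone_eq_of_card_fiber {q : ℕ} {f g : Fin n → Fin q} (hf : Monotone f)
    (hg : Monotone g) (h : ∀ j, #{a | f a = j} = #{a | g a = j}) : f = g := by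
  have hlt : ∀ (f : Fin n → Fin q) (j : Fin q), #{a | f a < j} = ∑ i ∈ Iio j, #{a | f a = i} := by
    intro f j
    rw [card_eq_sum_card_fiberwise (f := f) (t := Iio j) (fun a ha => by simpa using ha)]
    refine sum_congr rfl fun i hi => congrArg card ?_
    ext a
    simp only [mem_filter, mem_univ, true_and, and_iff_right_iff_imp]
    rintro rfl
    simpa using hi
  -- For monotone `f`, `f a < j` says that `a` is less than the number of points with value below
  -- `j`, which the fibre sizes determine.
  have key : ∀ a j, f a < j ↔ g a < j := by
    intro a j
    rw [← Tuple.lt_card_lt_iff_apply_lt_of_monotone (j := a) hf,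
      ← Tuple.lt_card_lt_iff_apply_lt_of_monotone (j := a) hg]
    have : #{a | f a < j} = #{a | g a < j} := by
      rw [hlt, hlt]
      exact sum_congr rfl fun i _ => h i
    simp only [this]
  funext a
  refine le_antisymm ?_ ?_
  · by_contra! H
    exact lt_irrefl _ ((key a _).2 H)
  · by_contra! H
    exact lt_irrefl _ ((key a _).1 H)

theorem des_subset_setOf_iff (α : Composition n) (x : Equiv.Perm (Fin n)) :
    Des x ⊆ setOf α ↔ ∀ a b, α.index a = α.index b → a < b → x a < x b := by
  constructor
  · intro h a b e hab
    refine rel_of_adjacent α.index (index_convex α) (fun a b => x a < x b)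
      (fun _ _ _ => lt_trans) ?_ a b hab e
    intro t ht
    by_contra H
    have hne : x (next t) ≠ x (here t) := fun h => by
      have := congrArg Fin.val (x.injective h)
      simp [next, here] at this
    have : t ∈ Des x := by
      simpa [Des] using lt_of_le_of_ne (not_lt.1 H) hne
    exact (mem_setOf_iff α t).1 (h this) ht
  · intro h t ht
    rw [mem_setOf_iff]
    intro e
    have h1 := h _ _ e (Fin.lt_def.2 (by simp [here, next]))
    have h2 : x (next t) < x (here t) := by simpa [Des] using ht
    exact lt_asymm h1 h2

/-! ### Permutations determined by an ordering -/

theorem perm_eq_of_lt_iff {x y : Equiv.Perm (Fin n)} (h : ∀ a b, x a < x b ↔ y a < y b) :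
    x = y := by
  have hm : Monotone (y * x⁻¹ : Equiv.Perm (Fin n)) := by
    refine StrictMono.monotone fun a b hab => ?_
    have := (h (x⁻¹ a) (x⁻¹ b)).1 (by simpa using hab)
    simpa using this
  have := (Equiv.Perm.monotone_iff _).1 hm
  exact (mul_inv_eq_one.1 this).symm

theorem exists_perm_lt_iff {L : Type*} [LinearOrder L] (key : Fin n → L)
    (hk : Function.Injective key) : ∃ y : Equiv.Perm (Fin n), ∀ a b, y a < y b ↔ key a < key b := by
  refine ⟨(Tuple.sort key)⁻¹, fun a b => ?_⟩
  have hm : StrictMono (key ∘ Tuple.sort key) :=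
    (Tuple.monotone_sort key).strictMono_of_injective (hk.comp (Equiv.injective _))
  have := hm.lt_iff_lt (a := (Tuple.sort key)⁻¹ a) (b := (Tuple.sort key)⁻¹ b)
  simpa using this.symm

/-! ### Sums of permutations with prescribed orders on blocks -/

/-- The permutations `w` and `z` order each fibre of `g` in the same way. -/
def SameOrder {ι : Type*} (g : Fin n → ι) (w z : Equiv.Perm (Fin n)) : Prop :=
  ∀ a b, g a = g b → w a < w b → z a < z b

theorem SameOrder.refl {ι : Type*} (g : Fin n → ι) (w : Equiv.Perm (Fin n)) : SameOrder g w w :=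
  fun _ _ _ h => h

theorem SameOrder.lt_iff {ι : Type*} {g : Fin n → ι} {w z : Equiv.Perm (Fin n)}
    (h : SameOrder g w z) {a b : Fin n} (e : g a = g b) : w a < w b ↔ z a < z b := by
  refine ⟨h a b e, fun hz => ?_⟩
  by_contra H
  rcases (not_lt.1 H).lt_or_eq with H | H
  · exact lt_asymm hz (h b a e.symm H)
  · rw [w.injective H] at hz
    exact lt_irrefl _ hz

theorem SameOrder.symm {ι : Type*} {g : Fin n → ι} {w z : Equiv.Perm (Fin n)}
    (h : SameOrder g w z) : SameOrder g z w := fun _ _ e => (h.lt_iff e).2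

theorem SameOrder.trans {ι : Type*} {g : Fin n → ι} {w z y : Equiv.Perm (Fin n)}
    (h : SameOrder g w z) (h' : SameOrder g z y) : SameOrder g w y :=
  fun a b e hw => h' a b e (h a b e hw)

open Classical in
/-- The sum of all permutations which order each fibre of `g` in the same way as `w` does. -/
noncomputable def chainSum (k : Type*) [CommRing k] {ι : Type*} (g : Fin n → ι)
    (w : Equiv.Perm (Fin n)) : MonoidAlgebra k (Equiv.Perm (Fin n)) :=
  ∑ z with SameOrder g w z, MonoidAlgebra.single z 1

variable (k : Type*) [CommRing k]

theorem chainSum_congr {ι κ : Type*} {g : Fin n → ι} {g' : Fin n → κ} {w w' : Equiv.Perm (Fin n)}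
    (hg : ∀ a b, g a = g b ↔ g' a = g' b) (hw : SameOrder g w w') :
    chainSum k g w = chainSum k g' w' := by
  refine sum_congr ?_ fun _ _ => rfl
  ext z
  have : SameOrder g w z ↔ SameOrder g w' z := ⟨hw.symm.trans, hw.trans⟩
  simp only [mem_filter, mem_univ, true_and, this]
  simp only [SameOrder, hg]

theorem chainSum_const (w : Equiv.Perm (Fin n)) :
    chainSum k (fun _ : Fin n => ()) w = MonoidAlgebra.single w 1 := by
  classical
  have : ({z | SameOrder (fun _ : Fin n => ()) w z} : Finset (Equiv.Perm (Fin n))) = {w} := by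
    ext z
    simp only [mem_filter, mem_univ, true_and, mem_singleton]
    exact ⟨fun h => (perm_eq_of_lt_iff fun a b => h.lt_iff rfl).symm, fun h => h ▸ SameOrder.refl _ _⟩
  rw [chainSum]
  convert sum_singleton _ w

theorem BSet_setOf_mul_single (α : Composition n) (w : Equiv.Perm (Fin n)) :
    BSet k (setOf α) * MonoidAlgebra.single w 1 = chainSum k (fun a => α.index (w a)) w := by
  rw [BSet, chainSum, sum_mul]
  refine sum_bij (fun x _ => x * w) ?_ ?_ ?_ ?_
  · intro x hx
    simp only [mem_filter, mem_univ, true_and, des_subset_setOf_iff] at hx ⊢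
    exact fun a b e h => hx _ _ e h
  · intro x _ y _ h
    exact mul_right_cancel h
  · intro z hz
    simp only [mem_filter, mem_univ, true_and] at hz
    refine ⟨z * w⁻¹, ?_, by simp⟩
    simp only [mem_filter, mem_univ, true_and, des_subset_setOf_iff]
    intro a b e h
    exact hz (w⁻¹ a) (w⁻¹ b) (by simpa using e) (by simpa using h)
  · intro x _
    simp [MonoidAlgebra.single_mul_single]

theorem lrmVector_eq_chainSum (w : Equiv.Perm (Fin n)) :
    lrmVector k w = chainSum k (fun a => (cLRM' w).index (w a)) w := by
  rw [← BSet_setOf_mul_single, cLRM', setOf_compOf, lrmVector]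

open Classical in
/-- The functions with fibre sizes given by `α` which are weakly increasing, for the order given
by `w`, on each fibre of `g`. -/
noncomputable def splittings (α : Composition n) {ι : Type*} (g : Fin n → ι)
    (w : Equiv.Perm (Fin n)) : Finset (Fin n → Fin α.length) :=
  {f | (∀ j, #{a | f a = j} = α.blocksFun j) ∧ ∀ a b, g a = g b → w a < w b → f a ≤ f b}

/-- Recovers `y` from `α.index ∘ y` and `x * y`, which gives the injectivity needed in
`B_mul_chainSum`. -/
theorem lt_iff_of_index {α : Composition n} {x y : Equiv.Perm (Fin n)}
    (hx : ∀ a b, α.index a = α.index b → a < b → x a < x b) (a b : Fin n) :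
    y a < y b ↔ toLex (α.index (y a), (x * y) a) < toLex (α.index (y b), (x * y) b) := by
  have key : ∀ a b, y a < y b →
      toLex (α.index (y a), (x * y) a) < toLex (α.index (y b), (x * y) b) := by
    intro a b h
    rw [Prod.Lex.toLex_lt_toLex]
    rcases (index_mono α h.le).lt_or_eq with h' | h'
    · exact Or.inl h'
    · exact Or.inr ⟨h', hx _ _ h' h⟩
  refine ⟨key a b, fun h => ?_⟩
  by_contra H
  rcases (not_lt.1 H).lt_or_eq with H | H
  · exact lt_asymm h (key b a H)
  · rw [y.injective H] at h
    exact lt_irrefl _ h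

/-- The action of `B_α` on a sum of permutations with prescribed orders on blocks. -/
theorem B_mul_chainSum (α : Composition n) {ι : Type*} (g : Fin n → ι) (w : Equiv.Perm (Fin n)) :
    B k α * chainSum k g w = ∑ f ∈ splittings α g w, chainSum k (fun a => (g a, f a)) w := by
  classical
  simp only [B, BSet, chainSum]
  rw [sum_mul_sum, ← sum_product', sum_sigma']
  refine sum_bij (fun p _ => ⟨fun a => α.index (p.2 a), p.1 * p.2⟩) ?_ ?_ ?_ ?_
  · rintro ⟨x, y⟩ h
    simp only [mem_product, mem_filter, mem_univ, true_and, des_subset_setOf_iff] at h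
    obtain ⟨hx, hy⟩ := h
    simp only [mem_sigma, splittings, mem_filter, mem_univ, true_and]
    refine ⟨⟨fun j => ?_, fun a b e h => index_mono α (hy a b e h).le⟩, ?_⟩
    · rw [← card_index_fiber]
      exact card_bij (fun a _ => y a) (by simp) (fun a _ b _ h => y.injective h)
        (fun b hb => ⟨y⁻¹ b, by simpa using hb, by simp⟩)
    · intro a b e h
      simp only [Prod.mk.injEq] at e
      exact hx _ _ e.2 (hy a b e.1 h)
  · rintro ⟨x, y⟩ h ⟨x', y'⟩ h' e
    simp only [mem_product, mem_filter, mem_univ, true_and, des_subset_setOf_iff] at h h'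
    simp only [Sigma.mk.injEq, heq_eq_eq] at e
    have hy : y = y' := by
      refine perm_eq_of_lt_iff fun a b => ?_
      rw [lt_iff_of_index h.1, lt_iff_of_index h'.1, e.2, congrFun e.1 a, congrFun e.1 b]
    subst hy
    rw [mul_right_cancel e.2]
  · rintro ⟨f, z⟩ h
    simp only [mem_sigma, splittings, mem_filter, mem_univ, true_and] at h
    obtain ⟨⟨hf, hm⟩, hz⟩ := h
    -- Inverse of the bijection: `y` ranks the letters by `f`, ties being broken by `z`.
    obtain ⟨y, hy⟩ := exists_perm_lt_iff (fun a => toLex (f a, z a))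
      (fun a b h => z.injective (Prod.ext_iff.1 (toLex.injective h)).2)
    simp only [Prod.Lex.toLex_lt_toLex] at hy
    have hind : f ∘ (y⁻¹ : Equiv.Perm (Fin n)) = α.index := by
      refine monotone_eq_of_card_fiber ?_ (index_mono α) fun j => ?_
      · intro a b hab
        rcases hab.lt_or_eq with hab | rfl
        · have := (hy (y⁻¹ a) (y⁻¹ b)).1 (by simpa using hab)
          exact this.elim le_of_lt fun h => h.1.le
        · exact le_rfl
      · rw [card_index_fiber, ← hf]
        exact card_bij (fun a _ => y⁻¹ a) (by simp) (fun a _ b _ h => (y⁻¹).injective h)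
          (fun b hb => ⟨y b, by simpa using hb, by simp⟩)
    have hfy : ∀ a, α.index (y a) = f a := fun a => by simp [← hind]
    refine ⟨(z * y⁻¹, y), ?_, ?_⟩
    · simp only [mem_product, mem_filter, mem_univ, true_and, des_subset_setOf_iff]
      constructor
      · intro a b e h
        have := (hy (y⁻¹ a) (y⁻¹ b)).1 (by simpa using h)
        rw [← hfy, ← hfy] at this
        simpa [e] using this
      · intro a b e h
        rw [hy]
        rcases (hm a b e h).lt_or_eq with h' | h'
        · exact Or.inl h'
        · exact Or.inr ⟨h', hz a b (by simp [e, h']) h⟩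
    · simp [hfy]
  · rintro ⟨x, y⟩ _
    simp [MonoidAlgebra.single_mul_single]

/-! ### Expansion into products of Lyndon words -/

open Classical in
/-- The smallest element of the fibre of `g` containing `a`. -/
noncomputable def blockMin {ι : Type*} (g : Fin n → ι) (a : Fin n) : Fin n :=
  ({c | g c = g a} : Finset (Fin n)).min' ⟨a, by simp⟩

theorem apply_blockMin {ι : Type*} (g : Fin n → ι) (a : Fin n) : g (blockMin g a) = g a := by
  classical
  exact (mem_filter.1 (min'_mem ({c | g c = g a} : Finset (Fin n)) ⟨a, by simp⟩)).2

theorem blockMin_le {ι : Type*} (g : Fin n → ι) {a c : Fin n} (h : g c = g a) :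
    blockMin g a ≤ c :=
  min'_le _ _ (by simpa using h)

theorem blockMin_eq_iff {ι : Type*} (g : Fin n → ι) (a b : Fin n) :
    blockMin g a = blockMin g b ↔ g a = g b := by
  refine ⟨fun h => by rw [← apply_blockMin g a, h, apply_blockMin g b], fun h => ?_⟩
  exact le_antisymm (blockMin_le g ((apply_blockMin g b).trans h.symm))
    (blockMin_le g ((apply_blockMin g a).trans h))

theorem blockMin_blockMin {ι : Type*} (g : Fin n → ι) (a : Fin n) :
    blockMin g (blockMin g a) = blockMin g a :=
  (blockMin_eq_iff g _ _).2 (apply_blockMin g a)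

open Classical in
/-- The elements preceding, in the order given by `w`, the smallest element of their fibre. -/
noncomputable def early {ι : Type*} (g : Fin n → ι) (w : Equiv.Perm (Fin n)) : Finset (Fin n) :=
  {a | w a < w (blockMin g a)}

theorem mem_early {ι : Type*} {g : Fin n → ι} {w : Equiv.Perm (Fin n)} {a : Fin n} :
    a ∈ early g w ↔ w a < w (blockMin g a) := by
  simp [early]

/-- The function whose fibres are obtained by cutting each fibre of `g` in front of its smallest
element. -/
noncomputable def cut {ι : Type*} (g : Fin n → ι) (w : Equiv.Perm (Fin n)) (a : Fin n) :
    ι × Prop := (g a, a ∈ early g w)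

theorem cut_eq_iff {ι : Type*} {g : Fin n → ι} {w : Equiv.Perm (Fin n)} {a b : Fin n} :
    cut g w a = cut g w b ↔ g a = g b ∧ (a ∈ early g w ↔ b ∈ early g w) := by
  simp [cut]

theorem blockMin_cut_of_notMem {ι : Type*} {g : Fin n → ι} {w : Equiv.Perm (Fin n)} {a : Fin n}
    (h : a ∉ early g w) : blockMin (cut g w) a = blockMin g a := by
  have hm : blockMin g a ∉ early g w := by
    rw [mem_early, blockMin_blockMin]; exact lt_irrefl _
  refine le_antisymm (blockMin_le _ ?_) (blockMin_le _ ?_)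
  · rw [cut_eq_iff]
    exact ⟨apply_blockMin g a, by simp [h, hm]⟩
  · exact (cut_eq_iff.1 (apply_blockMin (cut g w) a)).1

/-- Late letters keep their block minimum, so stay late; the smallest early letter of a fibre
becomes the minimum of its own piece. -/
theorem early_cut_ssubset {ι : Type*} {g : Fin n → ι} {w : Equiv.Perm (Fin n)}
    (h : (early g w).Nonempty) : early (cut g w) w ⊂ early g w := by
  rw [ssubset_iff_of_subset]
  · obtain ⟨a, ha⟩ := h
    refine ⟨blockMin (cut g w) a, ?_, ?_⟩
    · exact (cut_eq_iff.1 (apply_blockMin (cut g w) a)).2.2 ha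
    · rw [mem_early, blockMin_blockMin]
      exact lt_irrefl _
  · intro a ha
    by_contra H
    rw [mem_early, blockMin_cut_of_notMem H, ← mem_early] at ha
    exact H ha

/-- In `z` the late piece still starts with the block minimum, so no letter becomes early. If `z`
differs from `w` on a fibre, some early letter has moved behind a late one, hence behind the
minimum. -/
theorem early_ssubset_of_sameOrder_cut {ι : Type*} {g : Fin n → ι} {w z : Equiv.Perm (Fin n)}
    (h : SameOrder (cut g w) w z) (h' : ¬ SameOrder g w z) : early g z ⊂ early g w := by
  have key : ∀ a, a ∉ early g w → z (blockMin g a) ≤ z a := by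
    intro a ha
    have hm : blockMin g a ∉ early g w := by
      rw [mem_early, blockMin_blockMin]; exact lt_irrefl _
    have ha' := ha
    rw [mem_early, not_lt] at ha'
    rcases ha'.lt_or_eq with hlt | heq
    · exact (h _ _ (cut_eq_iff.2 ⟨apply_blockMin g a, by simp [ha, hm]⟩) hlt).le
    · rw [w.injective heq]
  rw [ssubset_iff_of_subset]
  · simp only [SameOrder, not_forall] at h'
    obtain ⟨a, b, e, hw, hz⟩ := h'
    have hm : blockMin g a = blockMin g b := (blockMin_eq_iff g a b).2 e
    have hne : ¬ (a ∈ early g w ↔ b ∈ early g w) := fun hc => hz (h a b (cut_eq_iff.2 ⟨e, hc⟩) hw)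
    have hba : b ∈ early g w → a ∈ early g w := by
      rw [mem_early, mem_early, hm]
      exact hw.trans
    have hb : b ∉ early g w := fun hb => hne ⟨fun _ => hb, hba⟩
    have ha : a ∈ early g w := by
      by_contra ha
      exact hne ⟨fun h => (ha h).elim, fun h => (hb h).elim⟩
    refine ⟨a, ha, ?_⟩
    rw [mem_early, not_lt, hm]
    exact (key b hb).trans (not_lt.1 hz)
  · intro a ha
    by_contra H
    exact absurd (mem_early.1 ha) (not_lt.2 (key a H))

/-- The span of the vectors `lrmVector k u` attached to permutations with at least `r`
left-to-right minima. -/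
noncomputable def lrmSpan (n r : ℕ) : Submodule k (MonoidAlgebra k (Equiv.Perm (Fin n))) :=
  Submodule.span k (lrmVector k '' {u | r ≤ (cLRM' u).length})

theorem lrmSpan_anti {r s : ℕ} (h : r ≤ s) : lrmSpan k n s ≤ lrmSpan k n r :=
  Submodule.span_mono (Set.image_mono fun _ hu => h.trans hu)

theorem ncard_range_congr {ι κ : Type*} {g : Fin n → ι} {g' : Fin n → κ}
    (h : ∀ a b, g a = g b ↔ g' a = g' b) : (Set.range g).ncard = (Set.range g').ncard := by
  have : ∀ x : Set.range g, ∃ a, g a = x := fun x => x.2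
  choose s hs using this
  refine Set.ncard_congr (fun x hx => g' (s ⟨x, hx⟩)) (fun x hx => ⟨_, rfl⟩) ?_ ?_
  · intro x y hx hy e
    rw [← h, hs, hs] at e
    exact e
  · rintro _ ⟨a, rfl⟩
    exact ⟨g a, ⟨a, rfl⟩, (h _ _).1 (hs _)⟩

theorem ncard_range_index (w : Equiv.Perm (Fin n)) (β : Composition n) :
    (Set.range fun a => β.index (w a)).ncard = β.length := by
  have : Set.range (fun a => β.index (w a)) = Set.univ :=
    ((index_surjective β).comp w.surjective).range_eq
  rw [this, Set.ncard_univ, Nat.card_eq_fintype_card, Fintype.card_fin]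

/-- If every fibre of `g` starts with its smallest element, then arranging the fibres in decreasing
order of these elements produces a permutation whose left-to-right minima separate the fibres. -/
theorem exists_perm_of_early_eq_empty {ι : Type*} {g : Fin n → ι} {w : Equiv.Perm (Fin n)}
    (h : early g w = ∅) : ∃ u, SameOrder g w u ∧
      ∀ a b, g a = g b ↔ (cLRM' u).index (u a) = (cLRM' u).index (u b) := by
  -- The word of `u` concatenates the fibres by decreasing minimum, each in the order of `w`.
  obtain ⟨u, hu⟩ := exists_perm_lt_iff
    (fun a => toLex (OrderDual.toDual (blockMin g a), w a))
    (fun a b h => w.injective (Prod.ext_iff.1 (toLex.injective h)).2)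
  simp only [Prod.Lex.toLex_lt_toLex, OrderDual.toDual_lt_toDual,
    OrderDual.toDual_inj] at hu
  have hwu : SameOrder g w u := fun a b e hw =>
    (hu a b).2 (Or.inr ⟨(blockMin_eq_iff g a b).2 e, hw⟩)
  have hmin : ∀ a, u (blockMin g a) ≤ u a := by
    intro a
    have h1 : a ∉ early g w := by simp [h]
    rw [mem_early, not_lt] at h1
    rcases h1.lt_or_eq with h1 | h1
    · exact (hwu _ _ (apply_blockMin g a) h1).le
    · rw [w.injective h1]
  have hanti : ∀ a b, u a ≤ u b → blockMin g b ≤ blockMin g a := by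
    intro a b hab
    rcases hab.lt_or_eq with hab | hab
    · exact ((hu a b).1 hab).elim le_of_lt fun h => h.1.ge
    · rw [u.injective hab]
  refine ⟨u, hwu, ?_⟩
  have hadj : ∀ t : Fin (n - 1),
      (cLRM' u).index (here t) = (cLRM' u).index (next t) ↔
        blockMin g (u⁻¹ (here t)) = blockMin g (u⁻¹ (next t)) := by
    intro t
    have hmem := mem_setOf_iff (cLRM' u) t
    rw [cLRM', setOf_compOf, ← cLRM'] at hmem
    obtain ⟨c, hc⟩ := u.surjective (next t)
    obtain ⟨d, hd⟩ := u.surjective (here t)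
    have hpos : ∀ e, u e < u c ↔ u e ≤ u d := fun e => by
      rw [hc, hd, Fin.lt_def, Fin.le_def]
      simp only [next, here]
      omega
    have hdc : u d < u c := (hpos d).2 le_rfl
    have hlrm : t ∈ LRM' u ↔ ∀ e, e < c → u c < u e := by
      simp [LRM', LRM, ← hc]
    rw [← not_iff_not, ← ne_eq, ← hmem, hlrm, ← hc, ← hd]
    simp only [Equiv.Perm.inv_def, Equiv.symm_apply_apply]
    constructor
    -- Were both positions in one fibre, its minimum would precede `c` and be smaller.
    · intro H e
      have h1 : u (blockMin g c) < u c := (hpos _).2 (e ▸ hmin d)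
      have h2 : blockMin g c ≠ c := fun h => by
        rw [h] at h1
        exact lt_irrefl _ h1
      exact lt_asymm h1 (H _ (lt_of_le_of_ne (blockMin_le g rfl) h2))
    -- At a change of fibre, `c` opens its fibre and so is its minimum; earlier letters are bounded
    -- below by minima of earlier fibres, which are at least `c`.
    · intro H
      have hlt : blockMin g c < blockMin g d := lt_of_le_of_ne (hanti _ _ hdc.le) (Ne.symm H)
      have hcc : blockMin g c = c := by
        by_contra hne
        have h1 : u (blockMin g c) < u c :=
          lt_of_le_of_ne (hmin c) fun h => hne (u.injective h)
        have h2 := hanti _ _ ((hpos _).1 h1)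
        rw [blockMin_blockMin] at h2
        exact absurd hlt (not_lt.2 h2)
      intro e hec
      by_contra hue
      have h1 : u e < u c := lt_of_le_of_ne (not_lt.1 hue) fun h => hec.ne (u.injective h)
      have h2 := hanti _ _ ((hpos _).1 h1)
      have h3 : blockMin g e ≤ e := blockMin_le g rfl
      rw [hcc] at hlt
      exact absurd (hlt.trans_le (h2.trans h3)) hec.asymm
  have hconv : ∀ a c b : Fin n, a ≤ c → c ≤ b →
      blockMin g (u⁻¹ a) = blockMin g (u⁻¹ b) → blockMin g (u⁻¹ a) = blockMin g (u⁻¹ c) := by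
    intro a c b hac hcb e
    refine le_antisymm ?_ (hanti _ _ (by simpa using hac))
    exact e ▸ hanti _ _ (by simpa using hcb)
  have hlt : ∀ i j, i < j → ((cLRM' u).index i = (cLRM' u).index j ↔
      blockMin g (u⁻¹ i) = blockMin g (u⁻¹ j)) := fun i j hij =>
    ⟨rel_of_adjacent _ (index_convex _) (fun i j => blockMin g (u⁻¹ i) = blockMin g (u⁻¹ j))
        (fun _ _ _ => Eq.trans) (fun t => (hadj t).1) i j hij,
      rel_of_adjacent (fun i => blockMin g (u⁻¹ i)) hconv
        (fun i j => (cLRM' u).index i = (cLRM' u).index j) (fun _ _ _ => Eq.trans)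
        (fun t => (hadj t).2) i j hij⟩
  intro a b
  rw [← blockMin_eq_iff]
  rcases lt_trichotomy (u a) (u b) with hab | hab | hab
  · simpa using (hlt _ _ hab).symm
  · simp [u.injective hab]
  · simpa [eq_comm] using (hlt _ _ hab).symm

/-- The sum for `cut g w` is `chainSum g w` plus sums `chainSum g z` with fewer early letters.
Solving for `chainSum g w` and inducting on the early letters never lowers the number of fibres. -/
theorem chainSum_mem_lrmSpan {ι : Type} (g : Fin n → ι) (w : Equiv.Perm (Fin n)) :
    chainSum k g w ∈ lrmSpan k n (Set.range g).ncard := by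
  classical
  induction hN : (early g w).card using Nat.strong_induction_on generalizing ι g w with
  | _ N ih =>
  subst hN
  rcases (early g w).eq_empty_or_nonempty with h0 | h0
  · obtain ⟨u, hu, hk⟩ := exists_perm_of_early_eq_empty h0
    rw [chainSum_congr k hk hu, ← lrmVector_eq_chainSum, ncard_range_congr hk, ncard_range_index]
    exact Submodule.subset_span ⟨u, le_refl (cLRM' u).length, rfl⟩
  · have hcut : chainSum k (cut g w) w ∈ lrmSpan k n (Set.range g).ncard := by
      refine lrmSpan_anti k ?_ (ih _ (card_lt_card (early_cut_ssubset h0)) (cut g w) w rfl)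
      have : Set.range g = Prod.fst '' Set.range (cut g w) := by
        rw [← Set.range_comp]; rfl
      rw [this]
      exact Set.ncard_image_le (Set.finite_range _)
    -- Group the shuffles of the cut pieces by the order they induce on the fibres of `g`.
    let s : Setoid (Equiv.Perm (Fin n)) :=
      ⟨SameOrder g, SameOrder.refl g, SameOrder.symm, SameOrder.trans⟩
    have hsub : ∀ {z z'}, SameOrder g z z' → SameOrder (cut g w) z z' :=
      fun h a b e => h a b (cut_eq_iff.1 e).1
    have hsplit : chainSum k (cut g w) w = ∑ q : Quotient s,
        ∑ z with SameOrder (cut g w) w z ∧ Quotient.mk s z = q, MonoidAlgebra.single z 1 := by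
      rw [chainSum, ← sum_fiberwise _ (fun z => Quotient.mk s z)]
      simp only [filter_filter]
    have hmk : ∀ z, SameOrder (cut g w) w z →
        ∑ y with SameOrder (cut g w) w y ∧ Quotient.mk s y = Quotient.mk s z,
          MonoidAlgebra.single y (1 : k) = chainSum k g z := by
      intro z hz
      refine sum_congr ?_ fun _ _ => rfl
      ext y
      have : Quotient.mk s y = Quotient.mk s z ↔ SameOrder g y z := Quotient.eq
      simp only [mem_filter, mem_univ, true_and, this]
      exact ⟨fun h => h.2.symm, fun h => ⟨hz.trans (hsub h), h.symm⟩⟩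
    rw [← add_sum_erase _ _ (mem_univ (Quotient.mk s w)), hmk w (SameOrder.refl _ _)] at hsplit
    rw [eq_sub_of_add_eq hsplit.symm]
    refine Submodule.sub_mem _ hcut (Submodule.sum_mem _ fun q hq => ?_)
    induction q using Quotient.inductionOn with
    | _ z =>
    by_cases hz : SameOrder (cut g w) w z
    · rw [hmk z hz]
      refine ih _ (card_lt_card (early_ssubset_of_sameOrder_cut hz fun h => ?_)) g z rfl
      exact (mem_erase.1 hq).1 (Quotient.sound h.symm)
    · rw [sum_eq_zero]
      · exact Submodule.zero_mem _
      · intro y hy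
        simp only [mem_filter, mem_univ, true_and] at hy
        have : SameOrder g y z := Quotient.eq.1 hy.2
        exact (hz (hy.1.trans (hsub this))).elim

/-! ### The basis and the triangular action -/

theorem span_lrmVector : Submodule.span k (Set.range (lrmVector k (n := n))) = ⊤ := by
  rw [eq_top_iff, ← (MonoidAlgebra.basis (Equiv.Perm (Fin n)) k).span_eq, Submodule.span_le]
  rintro _ ⟨w, rfl⟩
  have h := chainSum_mem_lrmSpan k (fun _ : Fin n => ()) w
  rw [chainSum_const] at h
  simpa using Submodule.span_mono (Set.image_subset_range _ _) h

/-- A spanning family whose size is the rank is independent; the zero ring is handled apart because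
the rank count needs `k` nontrivial. -/
theorem linearIndependent_lrmVector : LinearIndependent k (lrmVector k (n := n)) := by
  rcases subsingleton_or_nontrivial k with hk | hk
  · exact Function.injective_of_subsingleton _
  · refine linearIndependent_of_top_le_span_of_card_eq_finrank (span_lrmVector k).ge ?_
    rw [Module.finrank_eq_card_basis (MonoidAlgebra.basis (Equiv.Perm (Fin n)) k)]

/-- The basis of the group algebra formed by the vectors `lrmVector k w`. -/
noncomputable def lrmBasis (n : ℕ) :
    Module.Basis (Equiv.Perm (Fin n)) k (MonoidAlgebra k (Equiv.Perm (Fin n))) :=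
  Module.Basis.mk (linearIndependent_lrmVector k) (span_lrmVector k).ge

theorem lrmBasis_apply (w : Equiv.Perm (Fin n)) : lrmBasis k n w = lrmVector k w := by
  simp [lrmBasis]

theorem le_length_of_mem_lrmSpan {r : ℕ} {x : MonoidAlgebra k (Equiv.Perm (Fin n))}
    (hx : x ∈ lrmSpan k n r) {u : Equiv.Perm (Fin n)} (hu : (lrmBasis k n).repr x u ≠ 0) :
    r ≤ (cLRM' u).length := by
  have h : lrmVector k = lrmBasis k n := (funext (lrmBasis_apply k)).symm
  rw [lrmSpan, h, Module.Basis.mem_span_image] at hx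
  exact hx (by simpa using hu)

open Classical in
-- A splitting constant on blocks factors through the block index, and its fibre sizes are then sums
-- of parts of `β`.
theorem card_splittings_const (α β : Composition n) (w : Equiv.Perm (Fin n)) :
    #{f ∈ splittings α (fun a => β.index (w a)) w |
      ∀ a b, β.index (w a) = β.index (w b) → f a = f b} = eta β α := by
  rw [eta, Fintype.card_subtype]
  symm
  have hcard : ∀ (f : Fin β.length → Fin α.length) (j : Fin α.length),
      #{a | f (β.index (w a)) = j} = ∑ i with f i = j, β.blocksFun i := by
    intro f j
    rw [card_eq_sum_card_fiberwise (f := fun a => β.index (w a)) (t := {i | f i = j})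
      (fun a ha => by simpa using ha)]
    refine sum_congr rfl fun i hi => ?_
    rw [← card_index_fiber]
    refine card_bij (fun a _ => w a) (by simp) (fun a _ b _ h => w.injective h)
      (fun b hb => ⟨w⁻¹ b, ?_, by simp⟩)
    simp only [mem_filter, mem_univ, true_and] at hb hi ⊢
    simp [hb, hi]
  refine card_bij (fun f _ a => f (β.index (w a))) ?_ ?_ ?_
  · intro f hf
    simp only [mem_filter, mem_univ, true_and, splittings] at hf ⊢
    exact ⟨⟨fun j => by rw [hf, ← hcard], fun a b e _ => (congrArg f e).le⟩,
      fun a b e => congrArg f e⟩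
  · intro f _ f' _ e
    exact ((index_surjective β).comp w.surjective).injective_comp_right e
  · intro f hf
    simp only [mem_filter, mem_univ, true_and, splittings] at hf
    obtain ⟨⟨h1, _⟩, h2⟩ := hf
    obtain ⟨s, hs⟩ := ((index_surjective β).comp w.surjective).hasRightInverse
    have hfs : ∀ a, f (s (β.index (w a))) = f a := fun a => h2 _ _ (hs _)
    refine ⟨f ∘ s, ?_, funext hfs⟩
    simp only [mem_filter, mem_univ, true_and]
    intro j
    rw [← hcard, ← h1]
    simp [hfs]

theorem ncard_range_lt {ι κ : Type*} (g : Fin n → ι) (f : Fin n → κ)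
    (h : ¬ ∀ a b, g a = g b → f a = f b) :
    (Set.range g).ncard < (Set.range fun a => (g a, f a)).ncard := by
  have hr : Set.range g = Prod.fst '' Set.range fun a => (g a, f a) := by
    rw [← Set.range_comp]; rfl
  rw [hr]
  refine lt_of_le_of_ne (Set.ncard_image_le (Set.finite_range _)) fun e => h ?_
  have hinj := (Set.ncard_image_iff (Set.finite_range _)).1 e
  intro a b hab
  exact (Prod.ext_iff.1 (hinj ⟨a, rfl⟩ ⟨b, rfl⟩ hab)).2

theorem B_mul_lrmVector (α : Composition n) (w : Equiv.Perm (Fin n)) :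
    B k α * lrmVector k w - (eta (cLRM' w) α : k) • lrmVector k w ∈
      lrmSpan k n ((cLRM' w).length + 1) := by
  classical
  rw [← card_splittings_const α (cLRM' w) w]
  set g : Fin n → Fin (cLRM' w).length := fun a => (cLRM' w).index (w a) with hg
  have hw : lrmVector k w = chainSum k g w := lrmVector_eq_chainSum k w
  rw [hw, B_mul_chainSum,
    ← sum_filter_add_sum_filter_not _ (fun f => ∀ a b, g a = g b → f a = f b)]
  have hconst : ∑ f ∈ splittings α g w with ∀ a b, g a = g b → f a = f b,
      chainSum k (fun a => (g a, f a)) w =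
      (#{f ∈ splittings α g w | ∀ a b, g a = g b → f a = f b} : k) • chainSum k g w := by
    rw [Nat.cast_smul_eq_nsmul]
    refine sum_eq_card_nsmul fun f hf => ?_
    refine chainSum_congr k (fun a b => ?_) (SameOrder.refl _ _)
    simp only [Prod.mk.injEq, and_iff_left_iff_imp]
    exact (mem_filter.1 hf).2 a b
  rw [hconst, add_sub_cancel_left]
  refine Submodule.sum_mem _ fun f hf => ?_
  refine lrmSpan_anti k ?_ (chainSum_mem_lrmSpan k _ w)
  have := ncard_range_lt g f (mem_filter.1 hf).2
  rwa [ncard_range_index] at this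

theorem sum_B_mul_lrmVector (c : Composition n → k) (w : Equiv.Perm (Fin n)) :
    (∑ α, c α • B k α) * lrmVector k w -
        (∑ α, c α * (eta (cLRM' w) α : k)) • lrmVector k w ∈
      lrmSpan k n ((cLRM' w).length + 1) := by
  rw [sum_mul, sum_smul, ← sum_sub_distrib]
  refine Submodule.sum_mem _ fun α _ => ?_
  rw [smul_mul_assoc, mul_smul, ← smul_sub]
  exact Submodule.smul_mem _ _ (B_mul_lrmVector k α w)

/-! ### Total order and characteristic polynomial -/

/-- A finite type has a linear order for which a given statistic is weakly decreasing. -/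
theorem exists_linearOrder_lt_of_lt {X : Type*} [Finite X] (f : X → ℕ) :
    ∃ _ : LinearOrder X, ∀ x y : X, f y < f x → x < y := by
  obtain ⟨m, ⟨e⟩⟩ := Finite.exists_equiv_fin X
  let key : X → ℕᵒᵈ ×ₗ Fin m := fun x => toLex (OrderDual.toDual (f x), e x)
  have hk : Function.Injective key := fun x y h =>
    e.injective (Prod.ext_iff.1 (toLex.injective h)).2
  refine ⟨LinearOrder.lift' key hk, fun x y h => ?_⟩
  exact Prod.Lex.toLex_lt_toLex.2 (Or.inl h)

theorem charpoly_of_lt {R X : Type*} [CommRing R] [Fintype X] [DecidableEq X]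
    (M : Matrix X X R) (f : X → ℕ) (h : ∀ x y, x ≠ y → M x y ≠ 0 → f y < f x) :
    M.charpoly = ∏ x, (Polynomial.X - Polynomial.C (M x x)) := by
  obtain ⟨_, ho⟩ := exists_linearOrder_lt_of_lt f
  refine Matrix.charpoly_of_isUpperTriangular M fun x y hxy => ?_
  by_contra hM
  exact lt_asymm hxy (ho x y (h x y (ne_of_gt hxy) hM))

end DescentAlgebra

theorem mainTheorem2 (n : ℕ) :
    ∃ _ : LinearOrder (Composition n),
      ∀ (k : Type*) [CommRing k],
        ∃ b : Module.Basis (Equiv.Perm (Fin n)) k (MonoidAlgebra k (Equiv.Perm (Fin n))),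
          (∀ w, b w = DescentAlgebra.lrmVector k w) ∧
          ∀ (c : Composition n → k) (a : MonoidAlgebra k (Equiv.Perm (Fin n))),
            a = ∑ α, c α • DescentAlgebra.B k α →
            (∀ u w, u ≠ w →
              LinearMap.toMatrix b b (LinearMap.mulLeft k a) u w ≠ 0 →
              DescentAlgebra.cLRM' u < DescentAlgebra.cLRM' w) ∧
            (∀ w, LinearMap.toMatrix b b (LinearMap.mulLeft k a) w w =
              ∑ α, c α * (DescentAlgebra.eta (DescentAlgebra.cLRM' w) α : k)) ∧
            (LinearMap.mulLeft k a).charpoly =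
              ∏ w : Equiv.Perm (Fin n), (Polynomial.X - Polynomial.C
                (∑ α, c α * (DescentAlgebra.eta (DescentAlgebra.cLRM' w) α : k))) := by
  -- Longer compositions come first. The order is fixed before `k`, so it depends only on `n`.
  obtain ⟨ord, hord⟩ :=
    DescentAlgebra.exists_linearOrder_lt_of_lt (fun α : Composition n => α.length)
  refine ⟨ord, fun k _ =>
    ⟨DescentAlgebra.lrmBasis k n, DescentAlgebra.lrmBasis_apply k, fun c a ha => ?_⟩⟩
  set b := DescentAlgebra.lrmBasis k n with hb
  set d : Equiv.Perm (Fin n) → k :=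
    fun w => ∑ α, c α * (DescentAlgebra.eta (DescentAlgebra.cLRM' w) α : k) with hd
  -- Splitting off the expected diagonal term leaves a vector supported on strictly longer
  -- compositions.
  have hrepr : ∀ u w, LinearMap.toMatrix b b (LinearMap.mulLeft k a) u w =
      (b.repr (a * b w - d w • b w)) u + d w * (if w = u then 1 else 0) := by
    intro u w
    rw [LinearMap.toMatrix_apply]
    simp [Finsupp.single_apply]
  have hmem : ∀ u w, b.repr (a * b w - d w • b w) u ≠ 0 →
      (DescentAlgebra.cLRM' w).length < (DescentAlgebra.cLRM' u).length := by
    intro u w h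
    refine DescentAlgebra.le_length_of_mem_lrmSpan k ?_ h
    rw [hb, DescentAlgebra.lrmBasis_apply, ha]
    exact DescentAlgebra.sum_B_mul_lrmVector k c w
  have hoff : ∀ u w, u ≠ w → LinearMap.toMatrix b b (LinearMap.mulLeft k a) u w ≠ 0 →
      (DescentAlgebra.cLRM' w).length < (DescentAlgebra.cLRM' u).length := by
    intro u w hne h
    rw [hrepr, if_neg hne.symm, mul_zero, add_zero] at h
    exact hmem u w h
  have hdiag : ∀ w, LinearMap.toMatrix b b (LinearMap.mulLeft k a) w w = d w := by
    intro w
    have h0 : b.repr (a * b w - d w • b w) w = 0 := by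
      by_contra h
      exact lt_irrefl _ (hmem w w h)
    rw [hrepr, h0, if_pos rfl, zero_add, mul_one]
  refine ⟨fun u w hne h => hord _ _ (hoff u w hne h), hdiag, ?_⟩
  rw [← LinearMap.charpoly_toMatrix _ b, DescentAlgebra.charpoly_of_lt _ _ hoff]
  simp only [hdiag, hd]
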